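/- **Definitions.** An *order unit normed space* $(V,u)$ is a partially ordered real linear space $V$ with a positive element $u$ such that (1) $V$ is archimedean: if $\{nv : n\in\mathbb N\}$ is bounded above then $-v\ge 0$ (where $\mathbb N=\{1,2,\dots\}$); (2) $u$ is an order unit: for each $v\in V$ there is $n\in\mathbb N$ with $v\le nu$. Its order-unit norm is $\|v\|=\inf\{\lambda\ge 0: -\lambda u\le v\le\lambda u\}$. It is an *order unit normed vector lattice* if moreover $V$ is a lattice; then $e\in V$ is *characteristic* if $e\wedge(u-e)=0$. A poset is *monotone $\sigma$-complete* if every bounded ascending sequence has a supremum and every bounded descending sequence has an infimum. Let $R$ be a real or complex unital associative algebra, $A\subseteq R$ a real linear subspace with a partial order, and $A^+=\{a\in A: a\ge 0\}$. For $S\subseteq A$ put $C(S)=\{b\in A: sb=bs \text{ for all } s\in S\}$. Then $A$ is a *GH-algebra* (with enveloping algebra $R$) if: $(A,1)$ is an order unit normed space; $a^2\in A^+$ for $a\in A$; $aba\in A^+$ for $a,b\in A^+$; if $a\in A$, $b\in A^+$ and $aba=0$, then $ab=ba=0$; every $a\in A^+$ has some $b\in A^+\cap C(C(\{a\}))$ with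 $b^2=a$; for every $a\in A$ there is $p=p^2\in A$ such that, for all $b\in A$, $ab=0\Leftrightarrow pb=0$; every $a\in A$ with $a\ge 1$ has an inverse in $A$; and every bounded ascending sequence $(a_n)$ of pairwise commuting elements of $A$ has a supremum in $A$ that lies in $C(C(\{a_n : n\in\mathbb N\}))$. Its *projections* are the $p\in A$ with $p^2=p$. It is *commutative* if $ab=ba$ for all $a,b\in A$. **Theorem.** (i) If $A$ is a commutative GH-algebra, then $(A,1)$ is an order unit normed vector lattice and $A$ is monotone $\sigma$-complete. (ii) Conversely, let $(V,u)$ be a monotone $\sigma$-complete order unit normed vector lattice. Then the set $B$ of characteristic elements of $V$, with the order of $V$, is a Boolean $\sigma$-algebra (a Boolean algebra in which every sequence has a supremum and an infimum). Moreover there is a bilinear associative multiplication on $V$ with unit element $u$ such that, with the given linear structure and partial order, $V$ is a commutative GH-algebra (with enveloping algebra $V$), $V$ is a Banach algebra under the order-unit norm (the norm is submultiplicative and complete), and the set of projections of $V$ is exactly $B$. -/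

import Mathlib

/-! ### Order unit normed spaces and vector lattices -/

/-- A poset is monotone σ-complete if every bounded ascending sequence has a supremum and every
bounded descending sequence has an infimum. -/
structure IsMonotoneSigmaComplete (P : Type*) [PartialOrder P] : Prop where
  exists_isLUB : ∀ s : ℕ → P, Monotone s → BddAbove (Set.range s) → ∃ x, IsLUB (Set.range s) x
  exists_isGLB : ∀ s : ℕ → P, Antitone s → BddBelow (Set.range s) → ∃ x, IsGLB (Set.range s) x

/-- `(V, u)` is an order unit normed space: `V` is an archimedean partially ordered real linear
space and `u` is a positive element that is an order unit. -/
structure IsOrderUnitNormedSpace (V : Type*) [AddCommGroup V] [Module ℝ V] [PartialOrder V]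
    (u : V) : Prop where
  isOrderedAddMonoid : IsOrderedAddMonoid V
  posSMulMono : PosSMulMono ℝ V
  archimedean : ∀ v : V, (∃ w : V, ∀ n : ℕ, 1 ≤ n → (n : ℝ) • v ≤ w) → 0 ≤ -v
  unit_nonneg : 0 ≤ u
  exists_le_smul_unit : ∀ v : V, ∃ n : ℕ, 1 ≤ n ∧ v ≤ (n : ℝ) • u

/-- The order-unit norm: the infimum of the `r ≥ 0` with `-ru ≤ v ≤ ru`. -/
noncomputable def orderUnitNorm {V : Type*} [AddCommGroup V] [Module ℝ V] [PartialOrder V]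
    (u v : V) : ℝ :=
  sInf {r : ℝ | 0 ≤ r ∧ -(r • u) ≤ v ∧ v ≤ r • u}

/-- An order unit normed vector lattice: an order unit normed space whose order is a lattice. -/
structure IsOrderUnitNormedVectorLattice (V : Type*) [AddCommGroup V] [Module ℝ V]
    [PartialOrder V] (u : V) : Prop extends IsOrderUnitNormedSpace V u where
  exists_sup : ∀ v w : V, ∃ x, IsLUB {v, w} x
  exists_inf : ∀ v w : V, ∃ x, IsGLB {v, w} x

/-- The characteristic elements of `(V, u)`: those `e` with `e ∧ (u - e) = 0`. -/
def characteristicElements {V : Type*} [AddCommGroup V] [PartialOrder V] (u : V) : Set V :=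
  {e | IsGLB {e, u - e} 0}

/-- A poset is a Boolean σ-algebra if its order is that of a Boolean algebra and all sequences
have a supremum and an infimum. -/
structure IsBooleanSigmaAlgebra (P : Type*) [PartialOrder P] : Prop where
  exists_booleanAlgebra : ∃ b : BooleanAlgebra P, ∀ x y : P, b.le x y ↔ x ≤ y
  exists_isLUB : ∀ s : ℕ → P, ∃ x, IsLUB (Set.range s) x
  exists_isGLB : ∀ s : ℕ → P, ∃ x, IsGLB (Set.range s) x

/-! ### Generalized Hermitian (GH-) algebras

`R` is the enveloping algebra and `A` a real linear subspace of `R` carrying its own partial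
order. A complex algebra `R` is covered, being a real algebra by restriction of scalars. -/

/-- The positive cone of `A`, as a subset of `R`. -/
def posCone {R : Type*} [Ring R] [Algebra ℝ R] (A : Submodule ℝ R) [PartialOrder A] : Set R :=
  {x | ∃ h : x ∈ A, (0 : A) ≤ ⟨x, h⟩}

/-- The commutant `C(S)`, computed in `A`. -/
def commutantIn {R : Type*} [Ring R] [Algebra ℝ R] (A : Submodule ℝ R) (S : Set R) : Set R :=
  {b | b ∈ A ∧ ∀ s ∈ S, s * b = b * s}

/-- `A` is a GH-algebra with enveloping algebra `R`: a synaptic algebra in which the axiom on norm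
limits of ascending commuting sequences is replaced by the (stronger) commutative Vigier
property. -/
structure IsGHAlgebra {R : Type*} [Ring R] [Algebra ℝ R] (A : Submodule ℝ R) [PartialOrder A] :
    Prop where
  one_mem : (1 : R) ∈ A
  isOrderUnitNormedSpace : IsOrderUnitNormedSpace A ⟨1, one_mem⟩
  sq_mem_posCone : ∀ a ∈ A, a * a ∈ posCone A
  mul_mul_mem_posCone : ∀ a ∈ posCone A, ∀ b ∈ posCone A, a * b * a ∈ posCone A
  mul_eq_zero_of_mul_mul_eq_zero :
    ∀ a ∈ A, ∀ b ∈ posCone A, a * b * a = 0 → a * b = 0 ∧ b * a = 0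
  exists_sqrt : ∀ a ∈ posCone A,
    ∃ b ∈ posCone A, b ∈ commutantIn A (commutantIn A {a}) ∧ b * b = a
  exists_carrier : ∀ a ∈ A, ∃ p ∈ A, p = p * p ∧ ∀ b ∈ A, a * b = 0 ↔ p * b = 0
  exists_inverse : ∀ a : A, ⟨1, one_mem⟩ ≤ a → ∃ b ∈ A, (a : R) * b = 1 ∧ b * (a : R) = 1
  commutative_vigier : ∀ a : ℕ → A, Monotone a → BddAbove (Set.range a) →
    (∀ m n, (a m : R) * a n = a n * a m) →
    ∃ x : A, (x : R) ∈ commutantIn A (commutantIn A (Set.range fun n => (a n : R))) ∧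
      IsLUB (Set.range a) x

/-- A commutative GH-algebra. -/
structure IsCommGHAlgebra {R : Type*} [Ring R] [Algebra ℝ R] (A : Submodule ℝ R)
    [PartialOrder A] : Prop extends IsGHAlgebra A where
  mul_comm : ∀ a ∈ A, ∀ b ∈ A, a * b = b * a

/-- The projections of `A`, i.e. its idempotents. -/
def projections {R : Type*} [Ring R] [Algebra ℝ R] (A : Submodule ℝ R) : Set R :=
  {p | p ∈ A ∧ p * p = p}

/-! ### Multiplications on a given vector space -/

/-- A bilinear associative multiplication on `V` with unit element `u`. -/
structure UnitalMultiplication (V : Type*) [AddCommGroup V] [Module ℝ V] (u : V) where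
  mul : V →ₗ[ℝ] V →ₗ[ℝ] V
  mul_assoc : ∀ x y z : V, mul (mul x y) z = mul x (mul y z)
  unit_mul : ∀ x : V, mul u x = x
  mul_unit : ∀ x : V, mul x u = x

namespace UnitalMultiplication

/-- The ring structure on `V`; the additive structure is the given one, and `1 = u`. -/
abbrev toRing {V : Type*} [AddCommGroup V] [Module ℝ V] {u : V} (m : UnitalMultiplication V u) :
    Ring V :=
  { (inferInstance : AddCommGroup V) with
    mul := fun x y => m.mul x y
    one := u
    mul_assoc := m.mul_assoc
    one_mul := m.unit_mul
    mul_one := m.mul_unit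
    zero_mul := fun x => by
      change m.mul 0 x = 0
      simp
    mul_zero := fun x => by
      change m.mul x 0 = 0
      simp
    left_distrib := fun x y z => by
      change m.mul x (y + z) = m.mul x y + m.mul x z
      simp
    right_distrib := fun x y z => by
      change m.mul (x + y) z = m.mul x z + m.mul y z
      simp }

/-- The real algebra structure on `V`; the scalar multiplication is the given one. -/
abbrev toAlgebra {V : Type*} [AddCommGroup V] [i : Module ℝ V] {u : V}
    (m : UnitalMultiplication V u) : @Algebra ℝ V _ m.toRing.toSemiring :=
  @Algebra.ofModule ℝ V _ m.toRing.toSemiring i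
    (fun r x y => by
      change m.mul (r • x) y = r • m.mul x y
      simp)
    (fun r x y => by
      change m.mul x (r • y) = r • m.mul x y
      simp)

end UnitalMultiplication

/-- `N` is a norm making the real algebra `R` a Banach algebra: a submultiplicative linear space
norm for which all Cauchy sequences converge. -/
def IsBanachAlgebraNorm {R : Type*} [Ring R] [Algebra ℝ R] (N : R → ℝ) : Prop :=
  (∃ f : AlgebraNorm ℝ R, ∀ x, f x = N x) ∧
  ∀ s : ℕ → R, (∀ ε > 0, ∃ K, ∀ m ≥ K, ∀ n ≥ K, N (s m - s n) < ε) →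
    ∃ x, ∀ ε > 0, ∃ K, ∀ n ≥ K, N (s n - x) < ε

/-! ### Commutative GH-algebras are vector lattices -/

section CommGHAlgebra

variable {R : Type*} [Ring R] [Algebra ℝ R] {A : Submodule ℝ R} [PartialOrder A]

/-! For (i), commutativity makes `A` closed under products and makes products of positive elements
positive. With `h` the positive square root of `a * a`, playing the role of `|a|`, and `p` the
carrier of `h + a`, the element `p * a = (h + a) / 2` is the positive part of `a`. Translation and
negation give all joins and meets, and the Vigier property is σ-completeness once all elements
commute.

For (ii), `V` is identified with some `C(X, ℝ)`, `X` compact. A maximal solid subspace omitting `u`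
has quotient `ℝ u`, hence yields a unital real lattice homomorphism. The archimedean property
supplies enough of these to determine the order (`exists_unitalLatticeHom_pos`). They form a compact
space, on which `V` is dense by the lattice form of Stone–Weierstrass; σ-completeness upgrades
density to surjectivity (`surjective_of_denseRange_of_isMonotoneSigmaComplete`). The pointwise
product is pulled back to `V`. Characteristic elements are then the 0-1 valued functions, and
monotone suprema in `C(X, ℝ)` supply the carriers and the countable Boolean operations. -/

theorem mem_posCone_coe {a : A} : (a : R) ∈ posCone A ↔ 0 ≤ a :=
  ⟨fun ⟨_, h⟩ => h, fun h => ⟨a.2, h⟩⟩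

theorem IsGHAlgebra.add_mem_posCone (hA : IsGHAlgebra A) {a b : R} (ha : a ∈ posCone A)
    (hb : b ∈ posCone A) : a + b ∈ posCone A := by
  have := hA.isOrderUnitNormedSpace.isOrderedAddMonoid
  obtain ⟨ha, ha'⟩ := ha
  obtain ⟨hb, hb'⟩ := hb
  exact ⟨A.add_mem ha hb, add_nonneg ha' hb'⟩

/-- Squares lie in `A`, and commutativity allows polarization. -/
theorem IsCommGHAlgebra.mul_mem (hA : IsCommGHAlgebra A) {a b : R} (ha : a ∈ A) (hb : b ∈ A) :
    a * b ∈ A := by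
  have h1 : (a + b) * (a + b) ∈ A := (hA.sq_mem_posCone _ (A.add_mem ha hb)).1
  have h2 : a * a ∈ A := (hA.sq_mem_posCone _ ha).1
  have h3 : b * b ∈ A := (hA.sq_mem_posCone _ hb).1
  have h4 : a * b = (1 / 2 : ℝ) • ((a + b) * (a + b) - a * a - b * b) := by
    have : (a + b) * (a + b) - a * a - b * b = (2 : ℝ) • (a * b) := by
      rw [two_smul, add_mul, mul_add, mul_add, hA.mul_comm b hb a ha]
      abel
    rw [this, smul_smul]
    norm_num
  rw [h4]
  exact A.smul_mem _ (A.sub_mem (A.sub_mem h1 h2) h3)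

/-- If `c` is a positive square root of `a`, then `a * b = c * b * c`. -/
theorem IsCommGHAlgebra.mul_mem_posCone (hA : IsCommGHAlgebra A) {a b : R}
    (ha : a ∈ posCone A) (hb : b ∈ posCone A) : a * b ∈ posCone A := by
  obtain ⟨c, hc, -, rfl⟩ := hA.exists_sqrt a ha
  have h := hA.mul_mul_mem_posCone c hc b hb
  rwa [mul_assoc, hA.mul_comm b hb.1 c hc.1, ← mul_assoc] at h

theorem IsCommGHAlgebra.exists_isLUB_zero (hA : IsCommGHAlgebra A) (a : A) :
    ∃ z : A, IsLUB {a, 0} z := by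
  have := hA.isOrderUnitNormedSpace.isOrderedAddMonoid
  obtain ⟨h, hh, -, hsq⟩ := hA.exists_sqrt _ (hA.sq_mem_posCone a a.2)
  obtain ⟨p, hp, hpp, hcar⟩ := hA.exists_carrier (h + a) (A.add_mem hh.1 a.2)
  have hpa : p * h = p * a := by
    have h0 : (h + a) * (h - a) = 0 := by
      rw [add_mul, mul_sub, mul_sub, hsq, hA.mul_comm a a.2 h hh.1]
      abel
    have := (hcar _ (A.sub_mem hh.1 a.2)).1 h0
    rwa [mul_sub, sub_eq_zero] at this
  have hq : 1 - p ∈ A := A.sub_mem hA.one_mem hp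
  have hy : h + a = p * a + p * a := by
    have h0 : p * (1 - p) = 0 := by rw [mul_sub, mul_one, ← hpp, sub_self]
    have h1 := (hcar _ hq).2 h0
    rw [mul_sub, mul_one, sub_eq_zero] at h1
    rw [h1, hA.mul_comm _ (A.add_mem hh.1 a.2) p hp, mul_add, hpa]
  have hp0 : p ∈ posCone A := by
    have := hA.sq_mem_posCone p hp
    rwa [← hpp] at this
  have hq0 : 1 - p ∈ posCone A := by
    have h1 : (1 - p) * (1 - p) = 1 - p := by
      rw [mul_sub, mul_one, sub_mul, one_mul, ← hpp, sub_self, sub_zero]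
    have := hA.sq_mem_posCone _ hq
    rwa [h1] at this
  -- The bounds are `p * a - a = (1 - p) * h` and `p * a = p * h`; leastness is `c - p * a = p * (c
  -- - a) + (1 - p) * c`.
  refine ⟨⟨p * a, hA.mul_mem hp a.2⟩, ?_, ?_⟩
  · rintro b (rfl | rfl)
    · rw [← sub_nonneg, ← mem_posCone_coe]
      have : (1 - p) * h = p * b - b := by
        rw [sub_mul, one_mul, hpa, eq_sub_of_add_eq hy]
        abel
      simpa [← this] using hA.mul_mem_posCone hq0 hh
    · rw [← mem_posCone_coe]
      change p * (a : R) ∈ posCone A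
      rw [← hpa]
      exact hA.mul_mem_posCone hp0 hh
  · intro c hc
    have h1 : (c : R) - a ∈ posCone A := by
      have : a ≤ c := hc (by simp)
      rwa [← sub_nonneg, ← mem_posCone_coe] at this
    have h2 : (c : R) ∈ posCone A := mem_posCone_coe.2 (hc (by simp))
    rw [← sub_nonneg, ← mem_posCone_coe]
    have h3 := hA.add_mem_posCone (hA.mul_mem_posCone hp0 h1) (hA.mul_mem_posCone hq0 h2)
    have h4 : p * ((c : R) - a) + (1 - p) * c = c - p * a := by noncomm_ring
    rw [h4] at h3
    exact h3

theorem IsCommGHAlgebra.isOrderUnitNormedVectorLattice (hA : IsCommGHAlgebra A) :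
    IsOrderUnitNormedVectorLattice A ⟨1, hA.one_mem⟩ := by
  have := hA.isOrderUnitNormedSpace.isOrderedAddMonoid
  have hsup : ∀ v w : A, ∃ x, IsLUB {v, w} x := by
    intro v w
    obtain ⟨z, hz⟩ := hA.exists_isLUB_zero (v - w)
    refine ⟨z + w, ?_, fun c hc => ?_⟩
    · rintro b (rfl | rfl)
      · exact sub_le_iff_le_add.1 (hz.1 (by simp))
      · exact le_add_of_nonneg_left (hz.1 (by simp))
    · rw [← le_sub_iff_add_le]
      refine hz.2 ?_
      rintro b (rfl | rfl)
      · exact sub_le_sub_right (hc (by simp)) w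
      · exact sub_nonneg.2 (hc (by simp))
  refine ⟨hA.isOrderUnitNormedSpace, hsup, fun v w => ?_⟩
  obtain ⟨z, hz⟩ := hsup (-v) (-w)
  refine ⟨-z, ?_, fun c hc => ?_⟩
  · rintro b (rfl | rfl)
    · exact neg_le.1 (hz.1 (by simp))
    · exact neg_le.1 (hz.1 (by simp))
  · rw [le_neg]
    refine hz.2 ?_
    rintro b (rfl | rfl)
    · exact neg_le_neg (hc (by simp))
    · exact neg_le_neg (hc (by simp))

theorem isGLB_range_neg {P ι : Type*} [AddCommGroup P] [PartialOrder P] [IsOrderedAddMonoid P]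
    {s : ι → P} {x : P} (h : IsLUB (Set.range fun i => -s i) x) : IsGLB (Set.range s) (-x) := by
  refine ⟨?_, fun c hc => ?_⟩
  · rintro _ ⟨i, rfl⟩
    exact neg_le.1 (h.1 ⟨i, rfl⟩)
  · rw [le_neg]
    refine h.2 ?_
    rintro _ ⟨i, rfl⟩
    exact neg_le_neg (hc ⟨i, rfl⟩)

theorem IsCommGHAlgebra.isMonotoneSigmaComplete (hA : IsCommGHAlgebra A) :
    IsMonotoneSigmaComplete A := by
  have := hA.isOrderUnitNormedSpace.isOrderedAddMonoid
  have hsup : ∀ s : ℕ → A, Monotone s → BddAbove (Set.range s) →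
      ∃ x, IsLUB (Set.range s) x := fun s hs hb =>
    let ⟨x, _, hx⟩ := hA.commutative_vigier s hs hb
      fun m n => hA.mul_comm _ (s m).2 _ (s n).2
    ⟨x, hx⟩
  refine ⟨hsup, fun s hs ⟨b, hb⟩ => ?_⟩
  obtain ⟨x, hx⟩ := hsup (fun n => -s n) (fun _ _ h => neg_le_neg (hs h))
    ⟨-b, by rintro _ ⟨n, rfl⟩; exact neg_le_neg (hb ⟨n, rfl⟩)⟩
  exact ⟨-x, isGLB_range_neg hx⟩

end CommGHAlgebra

/-! ### Solid subspaces and real-valued lattice homomorphisms -/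

section SolidSubspace

variable {V : Type*} [AddCommGroup V] [Lattice V] [Module ℝ V]

/-- A subspace of a vector lattice is solid if it contains every element dominated in absolute
value by one of its members. -/
def Submodule.IsSolid (I : Submodule ℝ V) : Prop :=
  ∀ z ∈ I, ∀ x, |x| ≤ |z| → x ∈ I

/-- A maximal solid subspace not containing `u`. -/
def Submodule.IsMaximalSolid (I : Submodule ℝ V) (u : V) : Prop :=
  Maximal (fun J : Submodule ℝ V => J.IsSolid ∧ u ∉ J) I

theorem Submodule.IsSolid.exists_le_isMaximalSolid {J : Submodule ℝ V} (hJ : J.IsSolid) {u : V}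
    (hu : u ∉ J) : ∃ I, J ≤ I ∧ I.IsMaximalSolid u := by
  refine zorn_le_nonempty₀ {J : Submodule ℝ V | J.IsSolid ∧ u ∉ J} ?_ J ⟨hJ, hu⟩
  intro c hc hchain y hy
  have hmem {z : V} : z ∈ sSup c ↔ ∃ I ∈ c, z ∈ I :=
    Submodule.mem_sSup_of_directed ⟨y, hy⟩ hchain.directedOn
  refine ⟨sSup c, ⟨?_, ?_⟩, fun z hz => le_sSup hz⟩
  · intro z hz x hx
    obtain ⟨I, hI, hzI⟩ := hmem.1 hz
    exact hmem.2 ⟨I, hI, (hc hI).1 z hzI x hx⟩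
  · intro h
    obtain ⟨I, hI, hzI⟩ := hmem.1 h
    exact (hc hI).2 hzI

namespace Submodule.IsSolid

variable {I : Submodule ℝ V}

theorem mem_of_abs_le (hI : I.IsSolid) {x z : V} (hz : z ∈ I) (h : |x| ≤ z) : x ∈ I :=
  hI z hz x (h.trans (le_abs_self z))

variable [IsOrderedAddMonoid V]

theorem mem_of_nonneg_of_le (hI : I.IsSolid) {x z : V} (hz : z ∈ I) (hx : 0 ≤ x) (h : x ≤ z) :
    x ∈ I :=
  hI.mem_of_abs_le hz (by rwa [abs_of_nonneg hx])

theorem abs_mem (hI : I.IsSolid) {x : V} (hx : x ∈ I) : |x| ∈ I :=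
  hI x hx _ (abs_abs x).le

end Submodule.IsSolid

variable [IsOrderedAddMonoid V]

theorem Submodule.IsMaximalSolid.not_unit_le {I : Submodule ℝ V} {u : V}
    (hI : I.IsMaximalSolid u) (hu : 0 ≤ u) {i : V} (hi : i ∈ I) : ¬ u ≤ i :=
  fun h => hI.1.2 (hI.1.1.mem_of_nonneg_of_le hi hu h)

variable [PosSMulMono ℝ V]

theorem smul_le_smul_of_le_of_nonneg {r s : ℝ} (h : r ≤ s) {x : V} (hx : 0 ≤ x) :
    r • x ≤ s • x := by
  rw [← sub_nonneg, ← sub_smul]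
  exact smul_nonneg (sub_nonneg.2 h) hx

/-- The subspace of elements dominated in absolute value by an element of `I` plus a multiple
of `y`. -/
def Submodule.solidAdjoin (I : Submodule ℝ V) (y : V) : Submodule ℝ V where
  carrier := {x | ∃ i ∈ I, ∃ c : ℝ, 0 ≤ c ∧ |x| ≤ i + c • y}
  zero_mem' := ⟨0, I.zero_mem, 0, le_rfl, by simp⟩
  add_mem' := by
    rintro a b ⟨i, hi, c, hc, h⟩ ⟨j, hj, d, hd, h'⟩
    refine ⟨i + j, I.add_mem hi hj, c + d, add_nonneg hc hd, ?_⟩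
    calc |a + b| ≤ |a| + |b| := abs_add_le a b
      _ ≤ (i + c • y) + (j + d • y) := add_le_add h h'
      _ = _ := by module
  smul_mem' := by
    rintro r x ⟨i, hi, c, hc, h⟩
    refine ⟨|r| • i, I.smul_mem _ hi, |r| * c, by positivity, ?_⟩
    have h1 : |r| • |x| ≤ |r| • i + (|r| * c) • y := by
      rw [mul_smul, ← smul_add]
      exact smul_le_smul_of_nonneg_left h (abs_nonneg r)
    refine le_trans (abs_le'.2 ⟨?_, ?_⟩) h1
    · rcases abs_cases r with ⟨h, h0⟩ | ⟨h, h0⟩ <;> rw [h]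
      · exact smul_le_smul_of_nonneg_left (le_abs_self x) h0
      · rw [← neg_smul_neg]
        exact smul_le_smul_of_nonneg_left (neg_le_abs x) (by linarith)
    · rcases abs_cases r with ⟨h, h0⟩ | ⟨h, h0⟩ <;> rw [h]
      · rw [← smul_neg]
        exact smul_le_smul_of_nonneg_left (neg_le_abs x) h0
      · rw [← neg_smul]
        exact smul_le_smul_of_nonneg_left (le_abs_self x) (by linarith)

theorem Submodule.isSolid_solidAdjoin (I : Submodule ℝ V) (y : V) :
    (I.solidAdjoin y).IsSolid := by
  rintro z ⟨i, hi, c, hc, h⟩ x hx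
  exact ⟨i, hi, c, hc, hx.trans h⟩

theorem Submodule.mem_solidAdjoin_self (I : Submodule ℝ V) (y : V) (hy : 0 ≤ y) :
    y ∈ I.solidAdjoin y :=
  ⟨0, I.zero_mem, 1, zero_le_one, by simp [abs_of_nonneg hy]⟩

theorem Submodule.IsSolid.le_solidAdjoin {I : Submodule ℝ V} (hI : I.IsSolid) (y : V) : I ≤ I.solidAdjoin y :=
  fun x hx => ⟨|x|, hI.abs_mem hx, 0, le_rfl, by simp⟩

namespace Submodule.IsMaximalSolid

variable {I : Submodule ℝ V} {u : V}

/-- By maximality, the solid subspace generated by `I` and `y` must contain `u`. -/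
theorem exists_unit_le (hI : I.IsMaximalSolid u) {y : V} (hy : 0 ≤ y) (hyI : y ∉ I) :
    ∃ i ∈ I, ∃ c : ℝ, 0 < c ∧ u ≤ i + c • y := by
  have hu : u ∈ I.solidAdjoin y := by
    by_contra hu
    exact hyI (hI.2 ⟨I.isSolid_solidAdjoin y, hu⟩ (hI.1.1.le_solidAdjoin y)
      (I.mem_solidAdjoin_self y hy))
  obtain ⟨i, hi, c, hc, h⟩ := hu
  -- Passing from `c` to `c + 1` makes the coefficient strictly positive.
  refine ⟨i, hi, c + 1, by linarith, (le_abs_self u).trans (h.trans ?_)⟩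
  exact add_le_add_right (smul_le_smul_of_le_of_nonneg (by linarith) hy) i

/-- Otherwise a positive multiple of `u - (|i| + |j|)`, with `i, j ∈ I`, lies below both `x⁺` and
`x⁻`. These are disjoint, so `u ≤ |i| + |j|`, which is impossible. This primality makes the quotient
by `I` totally ordered. -/
theorem posPart_mem_or_negPart_mem (hI : I.IsMaximalSolid u) (hu : 0 ≤ u) (x : V) :
    x⁺ ∈ I ∨ x⁻ ∈ I := by
  by_contra! h
  obtain ⟨i, hi, c, hc, h1⟩ := hI.exists_unit_le (posPart_nonneg x) h.1
  obtain ⟨j, hj, d, hd, h2⟩ := hI.exists_unit_le (negPart_nonneg x) h.2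
  have key {k l y : V} {c e : ℝ} (hc : 0 < c) (hce : c ≤ e) (hy : 0 ≤ y)
      (h : u ≤ k + c • y) : e⁻¹ • (u - (|k| + |l|)) ≤ y := by
    rw [inv_smul_le_iff_of_pos (hc.trans_le hce), sub_le_iff_le_add']
    refine h.trans (add_le_add ?_ (smul_le_smul_of_le_of_nonneg hce hy))
    exact (le_abs_self k).trans (le_add_of_nonneg_right (abs_nonneg l))
  have h3 := key (l := j) hc (le_max_left c d) (posPart_nonneg x) h1
  have h4 := key (l := i) hd (le_max_right c d) (negPart_nonneg x) h2
  rw [add_comm |j|] at h4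
  have h5 := le_inf h3 h4
  rw [posPart_inf_negPart_eq_zero, inv_smul_le_iff_of_pos (hc.trans_le (le_max_left c d)),
    smul_zero, sub_nonpos] at h5
  exact hI.not_unit_le hu (I.add_mem (hI.1.1.abs_mem hi) (hI.1.1.abs_mem hj)) h5

/-- The quotient by `I` has no nonzero infinitesimals: if `u ≤ i + c • y`, then `ε = 1 / (2c)` makes
the contribution of `y` at most half of `u` modulo `I`, and that half can be absorbed on the left.
-/
theorem mem_of_forall_le_add_smul (hI : I.IsMaximalSolid u) (hu : 0 ≤ u) {y : V} (hy : 0 ≤ y)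
    (h : ∀ ε : ℝ, 0 < ε → ∃ i ∈ I, y ≤ i + ε • u) : y ∈ I := by
  by_contra hyI
  obtain ⟨i, hi, c, hc, h1⟩ := hI.exists_unit_le hy hyI
  obtain ⟨j, hj, h2⟩ := h (1 / (2 * c)) (by positivity)
  refine hI.not_unit_le hu (i := (2 : ℝ) • i + (2 * c) • j)
    (I.add_mem (I.smul_mem _ hi) (I.smul_mem _ hj)) ?_
  have h3 : u ≤ i + c • (j + (1 / (2 * c)) • u) :=
    h1.trans (add_le_add_right (smul_le_smul_of_nonneg_left h2 hc.le) i)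
  have h4 : i + c • (j + (1 / (2 * c)) • u) = i + c • j + (1 / 2 : ℝ) • u := by
    rw [smul_add, smul_smul, add_assoc]
    congr 3
    field_simp
  rw [h4, ← sub_le_iff_le_add] at h3
  calc u = (2 : ℝ) • (u - (1 / 2 : ℝ) • u) := by module
    _ ≤ (2 : ℝ) • (i + c • j) := smul_le_smul_of_nonneg_left h3 zero_le_two
    _ = _ := by module

/-- The scalar is a Dedekind cut: the infimum of the `r` with `v ≤ r • u` modulo `I`. Slightly above
it the positive part of `v - r • u` is in `I`; slightly below, primality puts the negative part in
`I`. Hence both parts at the infimum are infinitesimal modulo `I`. -/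
theorem exists_sub_smul_mem (hI : I.IsMaximalSolid u) (hu : 0 ≤ u)
    (hunit : ∀ v : V, ∃ n : ℕ, v ≤ (n : ℝ) • u) (v : V) : ∃ r : ℝ, v - r • u ∈ I := by
  set S : Set ℝ := {r | (v - r • u)⁺ ∈ I} with hS
  have hne : S.Nonempty := by
    obtain ⟨n, hn⟩ := hunit v
    refine ⟨n, ?_⟩
    simp [hS, posPart_eq_zero.2 (sub_nonpos.2 hn)]
  have hbdd : BddBelow S := by
    obtain ⟨m, hm⟩ := hunit (-v)
    refine ⟨-m, fun r hr => ?_⟩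
    by_contra! hlt
    have h1 : (-(m : ℝ) - r) • u ≤ (v - r • u)⁺ := by
      refine le_trans ?_ (le_posPart _)
      rw [sub_smul, neg_smul]
      exact sub_le_sub_right (_root_.neg_le.1 hm) _
    have h2 : 0 < -(m : ℝ) - r := by linarith
    have h3 := I.smul_mem (-(m : ℝ) - r)⁻¹ (hI.1.1.mem_of_nonneg_of_le hr
      (smul_nonneg h2.le hu) h1)
    rw [inv_smul_smul₀ h2.ne'] at h3
    exact hI.1.2 h3
  refine ⟨sInf S, ?_⟩
  rw [← posPart_sub_negPart (v - sInf S • u)]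
  refine I.sub_mem (hI.mem_of_forall_le_add_smul hu (posPart_nonneg _) fun ε hε => ?_)
    (hI.mem_of_forall_le_add_smul hu (negPart_nonneg _) fun ε hε => ?_)
  · obtain ⟨r, hr, hlt⟩ := exists_lt_of_csInf_lt hne (lt_add_of_pos_right (sInf S) hε)
    refine ⟨_, hr, sup_le ?_ (add_nonneg (posPart_nonneg _) (smul_nonneg hε.le hu))⟩
    calc v - sInf S • u = (v - r • u) + (r - sInf S) • u := by module
      _ ≤ _ := add_le_add (le_posPart _) (smul_le_smul_of_le_of_nonneg (by linarith) hu)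
  · have hr : sInf S - ε ∉ S := fun h => by linarith [csInf_le hbdd h]
    refine ⟨_, (hI.posPart_mem_or_negPart_mem hu (v - (sInf S - ε) • u)).resolve_left hr,
      sup_le ?_ (add_nonneg (negPart_nonneg _) (smul_nonneg hε.le hu))⟩
    calc -(v - sInf S • u) = -(v - (sInf S - ε) • u) + ε • u := by module
      _ ≤ _ := add_le_add_left (neg_le_negPart _) _

end Submodule.IsMaximalSolid

variable (V) in
/-- The unital real-valued lattice homomorphisms on `(V, u)`, as functions. -/
def unitalLatticeHoms (u : V) : Set (V → ℝ) :=
  {φ | (∀ x y, φ (x + y) = φ x + φ y) ∧ (∀ (r : ℝ) x, φ (r • x) = r * φ x) ∧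
    (∀ x y, φ (x ⊔ y) = φ x ⊔ φ y) ∧ φ u = 1}

theorem Submodule.IsMaximalSolid.exists_unitalLatticeHom {I : Submodule ℝ V} {u : V}
    (hI : I.IsMaximalSolid u) (hu : 0 ≤ u) (hunit : ∀ v : V, ∃ n : ℕ, v ≤ (n : ℝ) • u) :
    ∃ φ ∈ unitalLatticeHoms V u, ∀ x ∈ I, φ x = 0 := by
  choose φ hφ using hI.exists_sub_smul_mem hu hunit
  have huniq {x : V} {r : ℝ} (h : x - r • u ∈ I) : φ x = r := by
    by_contra hne
    have h1 := I.smul_mem (φ x - r)⁻¹ (I.sub_mem h (hφ x))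
    rw [show x - r • u - (x - φ x • u) = (φ x - r) • u by module,
      inv_smul_smul₀ (sub_ne_zero.2 hne)] at h1
    exact hI.1.2 h1
  have hker {x : V} (h : x ∈ I) : φ x = 0 := huniq (by simpa using h)
  have hadd (x y : V) : φ (x + y) = φ x + φ y := huniq <| by
    convert I.add_mem (hφ x) (hφ y) using 1
    module
  have hsmul (r : ℝ) (x : V) : φ (r • x) = r * φ x := huniq <| by
    convert I.smul_mem r (hφ x) using 1
    module
  have hneg (x : V) : φ (-x) = -φ x := by simpa using hsmul (-1) x
  have hsub (x y : V) : φ (x - y) = φ x - φ y := by rw [sub_eq_add_neg, hadd, hneg, sub_eq_add_neg]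
  have hpos {x : V} (hx : 0 ≤ x) : 0 ≤ φ x := by
    by_contra! hlt
    -- For `x ≥ 0` with `φ x < 0`, this element of `I` would dominate `u`.
    have h1 := I.smul_mem (-φ x)⁻¹ (hφ x)
    refine hI.not_unit_le hu h1 ?_
    rw [le_inv_smul_iff_of_pos (by linarith), neg_smul, sub_eq_add_neg]
    exact le_add_of_nonneg_left hx
  have hposPart (x : V) : φ x⁺ = φ x ⊔ 0 := by
    have h := hsub x⁺ x⁻
    rw [posPart_sub_negPart] at h
    rcases hI.posPart_mem_or_negPart_mem hu x with h1 | h1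
    · rw [hker h1] at h ⊢
      rw [sup_eq_right.2]
      linarith [hpos (negPart_nonneg x)]
    · rw [hker h1] at h
      rw [sup_eq_left.2] <;> linarith [hpos (posPart_nonneg x)]
  refine ⟨φ, ⟨hadd, hsmul, fun x y => ?_, huniq (by simp)⟩, fun x hx => hker hx⟩
  rw [sup_eq_add_posPart_sub, hadd, hposPart, hsub, ← max_add_add_left]
  simp

/-- The archimedean property gives `n` with `y = n • w - u` not `≤ 0`. The solid subspace generated
by `y⁻` omits `u`: otherwise `y⁺` would be dominated by a multiple of the disjoint element `y⁻`. A
homomorphism killing `y⁻` has `φ y ≥ 0`, that is, `n * φ w ≥ 1`. -/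
theorem exists_unitalLatticeHom_pos {u : V} (hu : IsOrderUnitNormedSpace V u) {w : V}
    (hw : ¬ w ≤ 0) : ∃ φ ∈ unitalLatticeHoms V u, 0 < φ w := by
  have hunit (v : V) : ∃ n : ℕ, v ≤ (n : ℝ) • u := (hu.exists_le_smul_unit v).imp fun _ h => h.2
  obtain ⟨n, hn, hnw⟩ : ∃ n : ℕ, 1 ≤ n ∧ ¬ (n : ℝ) • w ≤ u := by
    by_contra! h
    exact hw (neg_nonneg.1 (hu.archimedean w ⟨u, h⟩))
  have hn0 : (0 : ℝ) < n := by exact_mod_cast hn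
  set y := (n : ℝ) • w - u with hy
  have huJ : u ∉ (⊥ : Submodule ℝ V).solidAdjoin y⁻ := by
    rintro ⟨i, hi, c, hc, h⟩
    rw [Submodule.mem_bot] at hi
    rw [hi, zero_add, abs_of_nonneg hu.unit_nonneg] at h
    obtain ⟨m, hm⟩ := hunit y⁺
    -- The extra `1` gives `d ≥ 1`, so that `d⁻¹ • y⁺` lies below `y⁺` as well as below `y⁻`.
    set d : ℝ := m * c + 1 with hd
    have hd0 : 0 < d := by positivity
    have h1 : d⁻¹ • y⁺ ≤ y⁻ := by
      rw [inv_smul_le_iff_of_pos hd0]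
      calc y⁺ ≤ (m : ℝ) • u := hm
        _ ≤ (m : ℝ) • c • y⁻ := smul_le_smul_of_nonneg_left h m.cast_nonneg
        _ = (m * c) • y⁻ := by rw [smul_smul]
        _ ≤ d • y⁻ := smul_le_smul_of_le_of_nonneg (by linarith) (negPart_nonneg y)
    have h2 : d⁻¹ • y⁺ ≤ y⁺ := by
      conv_rhs => rw [← one_smul ℝ y⁺]
      refine smul_le_smul_of_le_of_nonneg (inv_le_one_of_one_le₀ ?_) (posPart_nonneg y)
      have : 0 ≤ (m : ℝ) * c := by positivity
      linarith
    have h3 := le_inf h2 h1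
    rw [posPart_inf_negPart_eq_zero, inv_smul_le_iff_of_pos hd0, smul_zero] at h3
    exact hnw (sub_nonpos.1 ((le_posPart y).trans h3))
  obtain ⟨I, hJI, hI⟩ := (Submodule.isSolid_solidAdjoin _ _).exists_le_isMaximalSolid huJ
  obtain ⟨φ, hφ, hφI⟩ := hI.exists_unitalLatticeHom hu.unit_nonneg hunit
  refine ⟨φ, hφ, ?_⟩
  have h1 : φ y⁻ = 0 := hφI _ (hJI (Submodule.mem_solidAdjoin_self _ _ (negPart_nonneg y)))
  obtain ⟨hadd, hsmul, hsup, hone⟩ := hφ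
  have hneg (x : V) : φ (-x) = -φ x := by simpa using hsmul (-1) x
  have h0 : φ 0 = 0 := by simpa using hsmul 0 0
  rw [negPart_def, hsup, hneg, h0] at h1
  have h2 : 0 ≤ φ y := by
    have := le_sup_left.trans h1.le
    linarith
  rw [hy, sub_eq_add_neg, hadd, hneg, hsmul, hone] at h2
  by_contra! hle
  nlinarith

end SolidSubspace

/-! ### Representation by continuous functions -/

section Representation

variable {V : Type*} [AddCommGroup V] [Module ℝ V]

/-- A linear order embedding onto a dense subspace of `C(X, ℝ)` is surjective if its domain is
monotone σ-complete. -/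
theorem surjective_of_denseRange_of_isMonotoneSigmaComplete [PartialOrder V]
    (hV : IsMonotoneSigmaComplete V) {X : Type*} [TopologicalSpace X] [CompactSpace X]
    (E : V →ₗ[ℝ] C(X, ℝ)) (hE : ∀ v w, E v ≤ E w ↔ v ≤ w) {u : V} (hu : E u = 1)
    (hdense : DenseRange E) : Function.Surjective E := by
  intro f
  have happrox (n : ℕ) : ∃ v, ∀ x, |E v x - f x| ≤ (1 / 2 : ℝ) ^ n := by
    obtain ⟨v, hv⟩ := hdense.exists_dist_lt f (ε := (1 / 2 : ℝ) ^ n) (by positivity)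
    refine ⟨v, fun x => ?_⟩
    rw [← Real.dist_eq, dist_comm]
    exact (ContinuousMap.dist_apply_le_dist x).trans hv.le
  choose v hv using happrox
  have hEu (n : ℕ) (c : ℝ) (x : X) : E (v n + c • u) x = E (v n) x + c := by
    simp [hu]
  -- The constant 3 makes `t` ascend: consecutive `v n` may drop by `(3/2) * (1/2)^n`, exactly the
  -- amount by which the shift shrinks.
  set t : ℕ → V := fun n => v n + (-(3 * (1 / 2 : ℝ) ^ n)) • u with ht
  have hEt (n : ℕ) (x : X) : E (t n) x = E (v n) x - 3 * (1 / 2 : ℝ) ^ n := by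
    rw [ht, hEu, sub_eq_add_neg]
  have hmono : Monotone t := by
    refine monotone_nat_of_le_succ fun n => (hE _ _).1 (ContinuousMap.le_def.2 fun x => ?_)
    rw [hEt, hEt]
    have h1 := abs_le.1 (hv n x)
    have h2 := abs_le.1 (hv (n + 1) x)
    rw [pow_succ] at h2 ⊢
    linarith
  have hle (m : ℕ) : v m + ((1 / 2 : ℝ) ^ m) • u ∈ upperBounds (Set.range t) := by
    rintro _ ⟨n, rfl⟩
    refine (hE _ _).1 (ContinuousMap.le_def.2 fun x => ?_)
    rw [hEt, hEu]
    have h1 := abs_le.1 (hv n x)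
    have h2 := abs_le.1 (hv m x)
    have : (0 : ℝ) < (1 / 2) ^ n := by positivity
    linarith
  obtain ⟨w, hw⟩ := hV.exists_isLUB t hmono ⟨_, hle 0⟩
  refine ⟨w, ContinuousMap.ext fun x => le_antisymm ?_ ?_⟩
  all_goals
    refine le_of_forall_pos_le_add fun ε hε => ?_
    -- From `t n ≤ w ≤ v n + (1/2)^n • u`, the error is at most `4 * (1/2)^n` below and `2 *
    -- (1/2)^n` above.
    obtain ⟨n, hn⟩ := exists_pow_lt_of_lt_one (show (0 : ℝ) < ε / 4 by positivity)
      (show (1 / 2 : ℝ) < 1 by norm_num)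
    have h1 := abs_le.1 (hv n x)
    have h2 : E (t n) x ≤ E w x := (hE _ _).2 (hw.1 ⟨n, rfl⟩) x
    have h3 : E w x ≤ E (v n + ((1 / 2 : ℝ) ^ n) • u) x := (hE _ _).2 (hw.2 (hle n)) x
    rw [hEt] at h2
    rw [hEu] at h3
    linarith

section Lattice

variable [Lattice V]

theorem isClosed_unitalLatticeHoms (u : V) : IsClosed (unitalLatticeHoms V u) := by
  have hev (x : V) : Continuous fun φ : V → ℝ => φ x := continuous_apply x
  simp only [unitalLatticeHoms, Set.ofPred_and, Set.ofPred_forall]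
  refine .inter ?_ (.inter ?_ (.inter ?_ ?_))
  · exact isClosed_iInter fun x => isClosed_iInter fun y =>
      isClosed_eq (hev _) ((hev x).add (hev y))
  · exact isClosed_iInter fun r => isClosed_iInter fun x =>
      isClosed_eq (hev _) (continuous_const.mul (hev x))
  · exact isClosed_iInter fun x => isClosed_iInter fun y =>
      isClosed_eq (hev _) ((hev x).sup (hev y))
  · exact isClosed_eq (hev u) continuous_const

theorem unitalLatticeHoms.mono {u : V} {φ : V → ℝ} (hφ : φ ∈ unitalLatticeHoms V u) :
    Monotone φ := fun x y h => by
  rw [← sup_eq_right.2 h, hφ.2.2.1]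
  exact le_sup_left

/-- Monotonicity and `φ u = 1` bound each `φ v` independently of `φ`, so Tychonoff applies. -/
theorem isCompact_unitalLatticeHoms {u : V} (hu : IsOrderUnitNormedSpace V u) :
    IsCompact (unitalLatticeHoms V u) := by
  choose n hn using fun v => hu.exists_le_smul_unit v
  refine IsCompact.of_isClosed_subset
    (isCompact_univ_pi fun v => isCompact_Icc (a := -(n (-v) : ℝ)) (b := n v))
    (isClosed_unitalLatticeHoms u) fun φ hφ v _ => ?_
  have h1 (v : V) : φ v ≤ n v := by
    have := unitalLatticeHoms.mono hφ (hn v).2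
    rwa [hφ.2.1, hφ.2.2.2, mul_one] at this
  have h2 := h1 (-v)
  rw [← neg_one_smul ℝ, hφ.2.1] at h2
  exact ⟨by simpa using neg_le.1 (by simpa using h2), h1 v⟩

/-- Evaluation of the elements of a vector lattice at the unital lattice homomorphisms. -/
def evalUnitalLatticeHoms (u : V) : V →ₗ[ℝ] C(unitalLatticeHoms V u, ℝ) where
  toFun v := ⟨fun φ => φ.1 v, (continuous_apply v).comp continuous_subtype_val⟩
  map_add' v w := ContinuousMap.ext fun φ => φ.2.1 v w
  map_smul' r v := ContinuousMap.ext fun φ => φ.2.2.1 r v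

theorem evalUnitalLatticeHoms_apply (u v : V) (φ : unitalLatticeHoms V u) :
    evalUnitalLatticeHoms u v φ = φ.1 v := rfl

theorem evalUnitalLatticeHoms_unit (u : V) : evalUnitalLatticeHoms u u = 1 :=
  ContinuousMap.ext fun φ => φ.2.2.2.2

theorem evalUnitalLatticeHoms_sup (u v w : V) : evalUnitalLatticeHoms u (v ⊔ w) =
    evalUnitalLatticeHoms u v ⊔ evalUnitalLatticeHoms u w :=
  ContinuousMap.ext fun φ => φ.2.2.2.1 v w

theorem evalUnitalLatticeHoms_le_iff [IsOrderedAddMonoid V] [PosSMulMono ℝ V] {u : V}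
    (hu : IsOrderUnitNormedSpace V u) (v w : V) :
    evalUnitalLatticeHoms u v ≤ evalUnitalLatticeHoms u w ↔ v ≤ w := by
  refine ⟨fun h => ?_, fun h φ => unitalLatticeHoms.mono φ.2 h⟩
  by_contra hvw
  obtain ⟨φ, hφ, hpos⟩ := exists_unitalLatticeHom_pos hu (w := v - w) (by rwa [sub_nonpos])
  have h1 : evalUnitalLatticeHoms u v ⟨φ, hφ⟩ ≤ evalUnitalLatticeHoms u w ⟨φ, hφ⟩ := h _
  have h2 : φ (v - w) = _ := (evalUnitalLatticeHoms_apply u (v - w) ⟨φ, hφ⟩).symm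
  rw [map_sub, ContinuousMap.sub_apply] at h2
  linarith

/-- Lattice Stone–Weierstrass requires a sublattice interpolating arbitrary values at any two
points; `u` and an element separating the points suffice. -/
theorem denseRange_evalUnitalLatticeHoms [IsOrderedAddMonoid V] {u : V}
    (hu : IsOrderUnitNormedSpace V u) : DenseRange (evalUnitalLatticeHoms u) := by
  have : CompactSpace (unitalLatticeHoms V u) :=
    isCompact_iff_compactSpace.1 (isCompact_unitalLatticeHoms hu)
  rw [DenseRange, dense_iff_closure_eq]
  refine ContinuousMap.sublattice_closure_eq_top _ ⟨_, 0, rfl⟩ ?_ ?_ ?_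
  · rintro _ ⟨v, rfl⟩ _ ⟨w, rfl⟩
    refine ⟨-(-v ⊔ -w), ?_⟩
    rw [map_neg, evalUnitalLatticeHoms_sup, map_neg, map_neg, neg_sup, neg_neg, neg_neg]
  · rintro _ ⟨v, rfl⟩ _ ⟨w, rfl⟩
    exact ⟨v ⊔ w, evalUnitalLatticeHoms_sup u v w⟩
  · intro g φ ψ
    by_cases h : φ = ψ
    · subst h
      refine ⟨_, ⟨g φ • u, rfl⟩, ?_⟩
      simp [evalUnitalLatticeHoms_unit]
    · obtain ⟨a, ha⟩ : ∃ a, φ.1 a ≠ ψ.1 a := by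
        by_contra! h1
        exact h (Subtype.ext (funext h1))
      have ha' : φ.1 a - ψ.1 a ≠ 0 := sub_ne_zero.2 ha
      refine ⟨_, ⟨((g φ - g ψ) / (φ.1 a - ψ.1 a)) • (a - ψ.1 a • u) + g ψ • u, rfl⟩, ?_, ?_⟩
      · simp [evalUnitalLatticeHoms_unit, evalUnitalLatticeHoms_apply, ha']
      · simp [evalUnitalLatticeHoms_unit, evalUnitalLatticeHoms_apply]

end Lattice

/-- The lattice operations of a vector lattice. -/
noncomputable abbrev IsOrderUnitNormedVectorLattice.lattice [o : PartialOrder V] {u : V}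
    (hV : IsOrderUnitNormedVectorLattice V u) : Lattice V :=
  { o with
    sup := fun v w => (hV.exists_sup v w).choose
    le_sup_left := fun v w => (hV.exists_sup v w).choose_spec.1 (by simp)
    le_sup_right := fun v w => (hV.exists_sup v w).choose_spec.1 (by simp)
    sup_le := fun v w x hv hw => (hV.exists_sup v w).choose_spec.2 (by simp [hv, hw])
    inf := fun v w => (hV.exists_inf v w).choose
    inf_le_left := fun v w => (hV.exists_inf v w).choose_spec.1 (by simp)
    inf_le_right := fun v w => (hV.exists_inf v w).choose_spec.1 (by simp)
    le_inf := fun x v w hv hw => (hV.exists_inf v w).choose_spec.2 (by simp [hv, hw]) }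

/-- A monotone σ-complete order unit normed vector lattice is `C(X, ℝ)` for a compact space `X`. -/
theorem IsOrderUnitNormedVectorLattice.exists_linearEquiv_continuousMap [PartialOrder V] {u : V}
    (hV : IsOrderUnitNormedVectorLattice V u) (hσ : IsMonotoneSigmaComplete V) :
    ∃ (X : Set (V → ℝ)) (_ : CompactSpace X) (E : V ≃ₗ[ℝ] C(X, ℝ)),
      E u = 1 ∧ ∀ v w, E v ≤ E w ↔ v ≤ w := by
  let : Lattice V := hV.lattice
  have := hV.isOrderedAddMonoid
  have := hV.posSMulMono
  have hu := hV.toIsOrderUnitNormedSpace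
  have hX : CompactSpace (unitalLatticeHoms V u) :=
    isCompact_iff_compactSpace.1 (isCompact_unitalLatticeHoms hu)
  have hle := evalUnitalLatticeHoms_le_iff hu
  refine ⟨unitalLatticeHoms V u, hX, .ofBijective (evalUnitalLatticeHoms u) ⟨?_, ?_⟩,
    evalUnitalLatticeHoms_unit u, hle⟩
  · exact fun v w h => le_antisymm ((hle v w).1 h.le) ((hle w v).1 h.ge)
  · exact surjective_of_denseRange_of_isMonotoneSigmaComplete hσ _ hle
      (evalUnitalLatticeHoms_unit u) (denseRange_evalUnitalLatticeHoms hu)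

end Representation

/-! ### Monotone σ-complete spaces of continuous functions -/

theorem OrderIso.isLUB_range_comp {P Q ι : Type*} [Preorder P] [Preorder Q] (e : P ≃o Q)
    {s : ι → P} {x : P} : IsLUB (Set.range fun i => e (s i)) (e x) ↔ IsLUB (Set.range s) x := by
  rw [← e.isLUB_image', ← Set.range_comp, Function.comp_def]

theorem OrderIso.isGLB_range_comp {P Q ι : Type*} [Preorder P] [Preorder Q] (e : P ≃o Q)
    {s : ι → P} {x : P} : IsGLB (Set.range fun i => e (s i)) (e x) ↔ IsGLB (Set.range s) x := by
  rw [← e.isGLB_image', ← Set.range_comp, Function.comp_def]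

theorem IsMonotoneSigmaComplete.of_orderIso {P Q : Type*} [PartialOrder P] [PartialOrder Q]
    (e : P ≃o Q) (h : IsMonotoneSigmaComplete P) : IsMonotoneSigmaComplete Q := by
  refine ⟨fun s hs hb => ?_, fun s hs hb => ?_⟩
  · obtain ⟨b, hb⟩ := hb
    obtain ⟨x, hx⟩ := h.exists_isLUB (fun n => e.symm (s n)) (e.symm.monotone.comp hs)
      ⟨e.symm b, by rintro _ ⟨n, rfl⟩; exact e.symm.monotone (hb ⟨n, rfl⟩)⟩
    exact ⟨e x, by simpa using e.isLUB_range_comp.2 hx⟩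
  · obtain ⟨b, hb⟩ := hb
    obtain ⟨x, hx⟩ := h.exists_isGLB (fun n => e.symm (s n)) (e.symm.monotone.comp_antitone hs)
      ⟨e.symm b, by rintro _ ⟨n, rfl⟩; exact e.symm.monotone (hb ⟨n, rfl⟩)⟩
    exact ⟨e x, by simpa using e.isGLB_range_comp.2 hx⟩

/-- Boolean algebra structures transport along order isomorphisms. -/
abbrev OrderIso.booleanAlgebra {P Q : Type*} [o : PartialOrder P] [BooleanAlgebra Q]
    (e : P ≃o Q) : BooleanAlgebra P :=
  { o with
    sup := fun x y => e.symm (e x ⊔ e y)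
    inf := fun x y => e.symm (e x ⊓ e y)
    compl := fun x => e.symm (e x)ᶜ
    top := e.symm ⊤
    bot := e.symm ⊥
    le_sup_left := fun x y => e.le_symm_apply.2 le_sup_left
    le_sup_right := fun x y => e.le_symm_apply.2 le_sup_right
    sup_le := fun x y z h h' => e.symm_apply_le.2 (sup_le (e.monotone h) (e.monotone h'))
    inf_le_left := fun x y => e.symm_apply_le.2 inf_le_left
    inf_le_right := fun x y => e.symm_apply_le.2 inf_le_right
    le_inf := fun x y z h h' => e.le_symm_apply.2 (le_inf (e.monotone h) (e.monotone h'))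
    le_sup_inf := fun x y z => by
      change e.symm (e (e.symm (e x ⊔ e y)) ⊓ e (e.symm (e x ⊔ e z))) ≤
        e.symm (e x ⊔ e (e.symm (e y ⊓ e z)))
      simpa using le_sup_inf
    inf_compl_le_bot := fun x => by
      change e.symm (e x ⊓ e (e.symm (e x)ᶜ)) ≤ e.symm ⊥
      simp
    top_le_sup_compl := fun x => by
      change e.symm ⊤ ≤ e.symm (e x ⊔ e (e.symm (e x)ᶜ))
      simp
    le_top := fun x => e.le_symm_apply.2 le_top
    bot_le := fun x => e.symm_apply_le.2 bot_le }

theorem IsBooleanSigmaAlgebra.of_orderIso {P Q : Type*} [PartialOrder P] [PartialOrder Q]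
    (e : P ≃o Q) (h : IsBooleanSigmaAlgebra Q) : IsBooleanSigmaAlgebra P := by
  refine ⟨?_, fun s => ?_, fun s => ?_⟩
  · obtain ⟨b, hb⟩ := h.exists_booleanAlgebra
    -- The order carried by `b` agrees with that of `Q` only up to `↔`, so `e` is repackaged as an
    -- isomorphism onto `b`'s order.
    exact ⟨@OrderIso.booleanAlgebra P Q _ b ⟨e.toEquiv, (hb _ _).trans e.le_iff_le⟩,
      fun _ _ => Iff.rfl⟩
  · obtain ⟨x, hx⟩ := h.exists_isLUB fun n => e (s n)
    exact ⟨e.symm x, e.isLUB_range_comp.1 (by simpa using hx)⟩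
  · obtain ⟨x, hx⟩ := h.exists_isGLB fun n => e (s n)
    exact ⟨e.symm x, e.isGLB_range_comp.1 (by simpa using hx)⟩

namespace ContinuousMap

variable {X : Type*} [TopologicalSpace X]

theorem mul_self_eq_self_iff {f : C(X, ℝ)} : f * f = f ↔ ∀ x, f x = 0 ∨ f x = 1 := by
  rw [ContinuousMap.ext_iff]
  refine forall_congr' fun x => ?_
  rw [mul_apply, ← sub_eq_zero, ← mul_sub_one, mul_eq_zero, sub_eq_zero]

theorem isGLB_pair_one_sub_zero_iff {f : C(X, ℝ)} : IsGLB {f, 1 - f} 0 ↔ f * f = f := by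
  rw [mul_self_eq_self_iff]
  have h1 : IsGLB {f, 1 - f} 0 ↔ f ⊓ (1 - f) = 0 :=
    ⟨fun h => isGLB_pair.unique h, fun h => h ▸ isGLB_pair⟩
  rw [h1, ContinuousMap.ext_iff]
  refine forall_congr' fun x => ?_
  change min (f x) (1 - f x) = 0 ↔ _
  rcases min_cases (f x) (1 - f x) with ⟨h, h'⟩ | ⟨h, h'⟩ <;> rw [h]
  · refine ⟨.inl, fun h => h.elim id fun h => by linarith⟩
  · refine ⟨fun h => .inr (by linarith), fun h => h.elim (fun h => by linarith) fun h => by linarith⟩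

/-- A supremum of functions bounded by `1` that is at least `1` wherever one of them is positive
is idempotent. -/
theorem mul_self_eq_self_of_isLUB {ι : Type*} {s : ι → C(X, ℝ)} {p : C(X, ℝ)}
    (hp : IsLUB (Set.range s) p) (h0 : 0 ≤ p) (h1 : ∀ i, s i ≤ 1)
    (h : ∀ i x, s i x ≤ 0 ∨ 1 ≤ p x) : p * p = p := by
  have hle : p ≤ 1 := hp.2 (by rintro _ ⟨i, rfl⟩; exact h1 i)
  -- This continuous function is again an upper bound of the family; `p ≤ max 0 (2p - 1)` with `0 ≤
  -- p ≤ 1` forces the values 0 and 1.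
  have hq : p ≤ 0 ⊔ (p + p - 1) := by
    refine hp.2 ?_
    rintro _ ⟨i, rfl⟩
    refine le_def.2 fun x => ?_
    rcases h i x with h2 | h2
    · exact h2.trans (le_max_left 0 (p x + p x - 1))
    · have : s i x ≤ 1 := le_def.1 (h1 i) x
      exact le_trans (by linarith) (le_max_right 0 (p x + p x - 1))
  refine mul_self_eq_self_iff.2 fun x => ?_
  have h2 : 0 ≤ p x := le_def.1 h0 x
  have h3 : p x ≤ 1 := le_def.1 hle x
  have h4 : p x ≤ max 0 (p x + p x - 1) := le_def.1 hq x
  rcases le_max_iff.1 h4 with h5 | h5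
  · exact .inl (le_antisymm h5 h2)
  · exact .inr (by linarith)

/-- The supremum `p` of the truncations `min (n|f|) 1` is 1 wherever `f ≠ 0`. -/
theorem exists_idempotent_mul_eq_zero_iff (hX : IsMonotoneSigmaComplete C(X, ℝ)) (f : C(X, ℝ)) :
    ∃ p : C(X, ℝ), p * p = p ∧ ∀ g, f * g = 0 ↔ p * g = 0 := by
  set s : ℕ → C(X, ℝ) := fun n => ((n : ℝ) • |f|) ⊓ 1 with hs
  have hsx (n : ℕ) (x : X) : s n x = min (n * |f x|) 1 := by simp [hs]
  have hmono : Monotone s := fun m n hmn => le_def.2 fun x => by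
    rw [hsx, hsx]
    have : (m : ℝ) ≤ n := by exact_mod_cast hmn
    gcongr
  have h1 (n : ℕ) : s n ≤ 1 := inf_le_right
  obtain ⟨p, hp⟩ := hX.exists_isLUB s hmono ⟨1, by rintro _ ⟨n, rfl⟩; exact h1 n⟩
  have hsp (n : ℕ) (x : X) : min (n * |f x|) 1 ≤ p x := by
    rw [← hsx]
    exact le_def.1 (hp.1 ⟨n, rfl⟩) x
  have h0 (x : X) : 0 ≤ p x := by simpa using hsp 0 x
  have hfp {x : X} (hx : f x ≠ 0) : 1 ≤ p x := by
    obtain ⟨n, hn⟩ := exists_nat_gt (1 / |f x|)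
    rw [div_lt_iff₀ (abs_pos.2 hx)] at hn
    simpa [min_eq_right hn.le] using hsp n x
  refine ⟨p, mul_self_eq_self_of_isLUB hp (le_def.2 h0) h1 fun n x => ?_, fun g => ⟨fun h => ?_,
    fun h => ?_⟩⟩
  · by_cases hx : f x = 0
    · exact .inl (by rw [hsx, hx]; simp)
    · exact .inr (hfp hx)
  -- When `f * g = 0`, these functions bound all truncations of `f`, and at a point with `g ≠ 0` one
  -- of them vanishes.
  · have hub (k : ℕ) : p ≤ 1 - ((k : ℝ) • |g|) ⊓ 1 := by
      refine hp.2 ?_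
      rintro _ ⟨n, rfl⟩
      refine le_def.2 fun x => ?_
      have h2 : (1 - ((k : ℝ) • |g|) ⊓ 1 : C(X, ℝ)) x = 1 - min (k * |g x|) 1 := by simp
      rw [hsx, h2]
      rcases mul_eq_zero.1 (show f x * g x = 0 from ContinuousMap.congr_fun h x) with h3 | h3
      · simp [h3]
      · simp [h3]
    ext x
    change p x * g x = 0
    by_cases hx : g x = 0
    · rw [hx, mul_zero]
    · obtain ⟨k, hk⟩ := exists_nat_gt (1 / |g x|)
      rw [div_lt_iff₀ (abs_pos.2 hx)] at hk
      have h2 : p x ≤ (1 - ((k : ℝ) • |g|) ⊓ 1 : C(X, ℝ)) x := le_def.1 (hub k) x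
      have h3 : (1 - ((k : ℝ) • |g|) ⊓ 1 : C(X, ℝ)) x = 1 - min (k * |g x|) 1 := by simp
      rw [h3, min_eq_right hk.le, sub_self] at h2
      rw [le_antisymm h2 (h0 x), zero_mul]
  · ext x
    change f x * g x = 0
    rcases mul_eq_zero.1 (show p x * g x = 0 from ContinuousMap.congr_fun h x) with h3 | h3
    · by_contra hx
      linarith [hfp (left_ne_zero_of_mul hx)]
    · rw [h3, mul_zero]

theorem sup_mul_self_eq_self {f g : C(X, ℝ)} (hf : f * f = f) (hg : g * g = g) :
    (f ⊔ g) * (f ⊔ g) = f ⊔ g := by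
  rw [mul_self_eq_self_iff] at *
  intro x
  rw [sup_apply]
  rcases max_choice (f x) (g x) with h | h <;> rw [h]
  exacts [hf x, hg x]

theorem one_sub_mul_self_eq_self {f : C(X, ℝ)} (hf : f * f = f) : (1 - f) * (1 - f) = 1 - f :=
  (show IsIdempotentElem f from hf).one_sub

/-- Finite joins of idempotents are idempotent, so the partial suprema form a bounded ascending
sequence with the same upper bounds. -/
theorem exists_isLUB_of_idempotent (hX : IsMonotoneSigmaComplete C(X, ℝ)) {s : ℕ → C(X, ℝ)}
    (hs : ∀ n, s n * s n = s n) : ∃ p : C(X, ℝ), p * p = p ∧ IsLUB (Set.range s) p := by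
  have hs' (n : ℕ) : partialSups s n * partialSups s n = partialSups s n := by
    induction n with
    | zero => exact hs 0
    | succ n ih =>
      rw [← Order.succ_eq_add_one, partialSups_succ]
      exact sup_mul_self_eq_self ih (hs _)
  have h1 (n : ℕ) : partialSups s n ≤ 1 := le_def.2 fun x => by
    rcases mul_self_eq_self_iff.1 (hs' n) x with h | h <;> rw [h] <;> simp
  obtain ⟨p, hp⟩ := hX.exists_isLUB (partialSups s) (partialSups s).monotone
    ⟨1, by rintro _ ⟨n, rfl⟩; exact h1 n⟩
  have hle (n : ℕ) (x : X) : partialSups s n x ≤ p x := le_def.1 (hp.1 ⟨n, rfl⟩) x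
  refine ⟨p, mul_self_eq_self_of_isLUB hp (le_def.2 fun x => ?_) h1 fun n x => ?_, ?_⟩
  · refine le_trans ?_ (hle 0 x)
    rcases mul_self_eq_self_iff.1 (hs' 0) x with h | h <;> rw [h] <;> simp
  · refine (mul_self_eq_self_iff.1 (hs' n) x).imp le_of_eq fun h => h.symm.le.trans (hle n x)
  · rwa [IsLUB, upperBounds_range_partialSups] at hp

theorem isBooleanSigmaAlgebra_idempotents (hX : IsMonotoneSigmaComplete C(X, ℝ)) :
    IsBooleanSigmaAlgebra {f : C(X, ℝ) | f * f = f} := by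
  refine ⟨⟨inferInstanceAs (BooleanAlgebra {f : C(X, ℝ) // IsIdempotentElem f}),
    fun f g => ?_⟩, fun s => ?_, fun s => ?_⟩
  -- The Boolean order on idempotents of a commutative ring is `f * g = f`; on 0-1 valued functions
  -- it is the pointwise order.
  · change f.1 * g.1 = f.1 ↔ f.1 ≤ g.1
    rw [ContinuousMap.ext_iff, le_def]
    refine forall_congr' fun x => ?_
    rw [mul_apply]
    rcases mul_self_eq_self_iff.1 f.2 x with h | h <;>
    rcases mul_self_eq_self_iff.1 g.2 x with h' | h' <;> rw [h, h'] <;> norm_num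
  · obtain ⟨p, hpp, hp⟩ := exists_isLUB_of_idempotent hX fun n => (s n).2
    refine ⟨⟨p, hpp⟩, ?_, fun q hq => hp.2 ?_⟩
    · rintro _ ⟨n, rfl⟩
      exact hp.1 ⟨n, rfl⟩
    · rintro _ ⟨n, rfl⟩
      exact hq ⟨n, rfl⟩
  · obtain ⟨p, hpp, hp⟩ := exists_isLUB_of_idempotent hX fun n => one_sub_mul_self_eq_self (s n).2
    refine ⟨⟨1 - p, one_sub_mul_self_eq_self hpp⟩, ?_, fun q hq => ?_⟩
    · rintro _ ⟨n, rfl⟩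
      exact sub_le_comm.1 (hp.1 ⟨n, rfl⟩)
    · suffices h : 1 - q.1 ∈ upperBounds (Set.range fun n => 1 - (s n).1) from
        le_sub_comm.1 (hp.2 h)
      rintro _ ⟨n, rfl⟩
      exact sub_le_sub_left (show q.1 ≤ (s n).1 from hq ⟨n, rfl⟩) 1

end ContinuousMap

/-! ### Algebras of continuous functions are GH-algebras -/

section TransportAlgebra

variable {V : Type*} [Ring V] [Algebra ℝ V] [PartialOrder V] {X : Type*} [TopologicalSpace X]

theorem mem_posCone_top_iff {E : V ≃ₐ[ℝ] C(X, ℝ)} (hE : ∀ v w, E v ≤ E w ↔ v ≤ w) {v : V} :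
    v ∈ posCone (⊤ : Submodule ℝ V) ↔ ∀ x, 0 ≤ E v x := by
  have h : v ∈ posCone (⊤ : Submodule ℝ V) ↔ 0 ≤ v := ⟨fun ⟨_, h⟩ => h, fun h => ⟨trivial, h⟩⟩
  rw [h, ← hE, map_zero, ContinuousMap.le_def]
  rfl

theorem isOrderUnitNormedSpace_top (hV : IsOrderUnitNormedSpace V 1) :
    IsOrderUnitNormedSpace (⊤ : Submodule ℝ V) ⟨1, Submodule.mem_top⟩ where
  isOrderedAddMonoid := by
    have := hV.isOrderedAddMonoid
    exact ⟨fun a b h c => add_le_add_left (α := V) h c, fun a b h c => add_le_add_right (α := V) h c⟩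
  posSMulMono := by
    have := hV.posSMulMono
    exact ⟨fun r hr a b h => smul_le_smul_of_nonneg_left (β := V) h hr⟩
  archimedean := fun v ⟨w, hw⟩ => hV.archimedean v ⟨w, hw⟩
  unit_nonneg := hV.unit_nonneg
  exists_le_smul_unit := fun v => hV.exists_le_smul_unit v

/-- Commutants are everything, and the algebraic axioms are checked pointwise. Only carriers and the
Vigier property need σ-completeness. -/
theorem isCommGHAlgebra_top_of_algEquiv (hV : IsOrderUnitNormedSpace V 1)
    (E : V ≃ₐ[ℝ] C(X, ℝ)) (hE : ∀ v w, E v ≤ E w ↔ v ≤ w)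
    (hX : IsMonotoneSigmaComplete C(X, ℝ)) : IsCommGHAlgebra (⊤ : Submodule ℝ V) := by
  have hcomm (a b : V) : a * b = b * a := E.injective (by rw [map_mul, map_mul, mul_comm])
  have hpos {v : V} := mem_posCone_top_iff hE (v := v)
  have hmem {S : Set V} (v : V) : v ∈ commutantIn (⊤ : Submodule ℝ V) S :=
    ⟨trivial, fun s _ => hcomm s v⟩
  have hmul (a b : V) (x : X) : E (a * b) x = E a x * E b x := by
    rw [map_mul, ContinuousMap.mul_apply]
  have hzero {a : V} : a = 0 ↔ ∀ x, E a x = 0 := by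
    rw [← map_eq_zero_iff E E.injective, ContinuousMap.ext_iff]
    rfl
  refine ⟨⟨trivial, isOrderUnitNormedSpace_top hV, ?_, ?_, ?_, ?_, ?_, ?_, ?_⟩, ?_⟩
  · intro a _
    rw [hpos]
    intro x
    rw [hmul]
    exact mul_self_nonneg _
  · intro a ha b hb
    rw [hpos] at *
    intro x
    rw [hmul, hmul]
    have := ha x
    have := hb x
    positivity
  · intro a _ b _ h
    rw [hcomm b a, and_self]
    rw [hzero] at *
    intro x
    have h1 := h x
    rw [hmul, hmul] at h1
    rw [hmul]
    exact (mul_eq_zero.1 h1).elim id fun h2 => by rw [h2, zero_mul]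
  · intro a ha
    rw [hpos] at ha
    let f : C(X, ℝ) := ⟨fun x => √(E a x), by fun_prop⟩
    refine ⟨E.symm f, hpos.2 fun x => ?_, hmem _, E.injective ?_⟩
    · rw [E.apply_symm_apply]
      exact Real.sqrt_nonneg _
    · ext x
      rw [hmul, E.apply_symm_apply]
      exact Real.mul_self_sqrt (ha x)
  · intro a _
    obtain ⟨p, hp, h⟩ := ContinuousMap.exists_idempotent_mul_eq_zero_iff hX (E a)
    refine ⟨E.symm p, trivial, by rw [← map_mul, hp], fun b _ => ?_⟩
    rw [← map_eq_zero_iff E E.injective, ← map_eq_zero_iff E E.injective, map_mul, map_mul,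
      E.apply_symm_apply, h]
  · intro a ha
    have h1 (x : X) : 1 ≤ E a x := by
      have := ContinuousMap.le_def.1 ((hE _ _).2 (show (1 : V) ≤ a from ha)) x
      rwa [map_one] at this
    have h0 (x : X) : E a x ≠ 0 := (zero_lt_one.trans_le (h1 x)).ne'
    let f : C(X, ℝ) := ⟨fun x => (E a x)⁻¹, (map_continuous (E a)).inv₀ h0⟩
    have h2 : (a : V) * E.symm f = 1 := E.injective <| by
      ext x
      rw [hmul, E.apply_symm_apply, map_one]
      exact mul_inv_cancel₀ (h0 x)
    exact ⟨E.symm f, trivial, h2, by rw [hcomm, h2]⟩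
  · intro a ha hb _
    let e : (⊤ : Submodule ℝ V) ≃o C(X, ℝ) :=
      { toFun := fun v => E v
        invFun := fun f => ⟨E.symm f, trivial⟩
        left_inv := fun v => Subtype.ext (E.symm_apply_apply v)
        right_inv := E.apply_symm_apply
        map_rel_iff' := hE _ _ }
    obtain ⟨x, hx⟩ := (hX.of_orderIso e.symm).exists_isLUB a ha hb
    exact ⟨x, hmem _, hx⟩
  · exact fun a _ b _ => hcomm a b

theorem orderUnitNorm_one_eq_norm [CompactSpace X] {E : V ≃ₐ[ℝ] C(X, ℝ)}
    (hE : ∀ v w, E v ≤ E w ↔ v ≤ w) (v : V) : orderUnitNorm 1 v = ‖E v‖ := by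
  have h : {r : ℝ | 0 ≤ r ∧ -(r • (1 : V)) ≤ v ∧ v ≤ r • 1} = Set.Ici ‖E v‖ := by
    ext r
    rw [Set.mem_Ici, Set.mem_ofPred_eq, ← hE, ← hE, map_neg, map_smul, map_one]
    refine ⟨fun ⟨h0, h1, h2⟩ => (ContinuousMap.norm_le _ h0).2 fun x => ?_, fun h => ?_⟩
    · have h3 := ContinuousMap.le_def.1 h1 x
      have h4 := ContinuousMap.le_def.1 h2 x
      simp only [ContinuousMap.neg_apply, ContinuousMap.smul_apply, ContinuousMap.one_apply,
        smul_eq_mul, mul_one] at h3 h4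
      exact abs_le.2 ⟨h3, h4⟩
    · have h3 (x : X) := abs_le.1 ((ContinuousMap.norm_coe_le_norm (E v) x).trans h)
      refine ⟨(norm_nonneg _).trans h, ContinuousMap.le_def.2 fun x => ?_,
        ContinuousMap.le_def.2 fun x => ?_⟩
      · simpa using (h3 x).1
      · simpa using (h3 x).2
  rw [orderUnitNorm, h, csInf_Ici]

theorem isBanachAlgebraNorm_orderUnitNorm_one [CompactSpace X] (E : V ≃ₐ[ℝ] C(X, ℝ))
    (hE : ∀ v w, E v ≤ E w ↔ v ≤ w) : IsBanachAlgebraNorm (orderUnitNorm (1 : V)) := by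
  refine ⟨⟨{ toFun := fun v => ‖E v‖
             map_zero' := by simp
             add_le' := fun v w => by simpa using norm_add_le (E v) (E w)
             neg' := by simp
             mul_le' := fun v w => by simpa using norm_mul_le (E v) (E w)
             eq_zero_of_map_eq_zero' := by simp
             smul' := fun r v => by simpa using norm_smul r (E v) },
    fun v => (orderUnitNorm_one_eq_norm hE v).symm⟩, fun s hs => ?_⟩
  have hcauchy : CauchySeq fun n => E (s n) := by
    rw [Metric.cauchySeq_iff]
    intro ε hε
    obtain ⟨K, hK⟩ := hs ε hε
    refine ⟨K, fun m hm n hn => ?_⟩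
    rw [dist_eq_norm, ← map_sub, ← orderUnitNorm_one_eq_norm hE]
    exact hK m hm n hn
  obtain ⟨f, hf⟩ := cauchySeq_tendsto_of_complete hcauchy
  rw [Metric.tendsto_atTop] at hf
  refine ⟨E.symm f, fun ε hε => (hf ε hε).imp fun K hK n hn => ?_⟩
  rw [orderUnitNorm_one_eq_norm hE, map_sub, E.apply_symm_apply, ← dist_eq_norm]
  exact hK n hn

/-- `E` is an order isomorphism, so it preserves the infimum defining characteristic elements; in
`C(X, ℝ)` that condition is `min t (1 - t) = 0` at each value `t`, so `t` is 0 or 1. -/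
theorem map_mem_idempotents_iff {W : Type*} [AddCommGroup W] [Module ℝ W] [PartialOrder W]
    {u : W} {E : W ≃ₗ[ℝ] C(X, ℝ)} (hu : E u = 1) (hE : ∀ v w, E v ≤ E w ↔ v ≤ w) {e : W} :
    E e * E e = E e ↔ e ∈ characteristicElements u := by
  let f : W ≃o C(X, ℝ) := { E.toEquiv with map_rel_iff' := hE _ _ }
  have h : f '' {e, u - e} = {E e, 1 - E e} := by
    rw [Set.image_pair, ← hu, ← map_sub]
    rfl
  rw [← ContinuousMap.isGLB_pair_one_sub_zero_iff, ← h, ← map_zero E]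
  exact f.isGLB_image'

end TransportAlgebra

/-- The multiplication on `V` transported from an algebra along a linear equivalence. -/
def UnitalMultiplication.ofLinearEquiv {V W : Type*} [AddCommGroup V] [Module ℝ V] [CommRing W]
    [Algebra ℝ W] (E : V ≃ₗ[ℝ] W) {u : V} (hu : E u = 1) : UnitalMultiplication V u where
  mul := LinearMap.mk₂ ℝ (fun v w => E.symm (E v * E w))
    (fun _ _ _ => by rw [map_add, add_mul, map_add])
    (fun _ _ _ => by rw [map_smul, smul_mul_assoc, map_smul])
    (fun _ _ _ => by rw [map_add, mul_add, map_add])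
    (fun _ _ _ => by rw [map_smul, mul_smul_comm, map_smul])
  mul_assoc := fun x y z => by simp [_root_.mul_assoc]
  unit_mul := fun x => by simp [hu]
  mul_unit := fun x => by simp [hu]

theorem IsOrderUnitNormedVectorLattice.isBooleanSigmaAlgebra_and_exists_multiplication
    {V : Type*} [AddCommGroup V] [Module ℝ V] [PartialOrder V] {u : V}
    (hV : IsOrderUnitNormedVectorLattice V u) (hσ : IsMonotoneSigmaComplete V) :
    IsBooleanSigmaAlgebra (characteristicElements u) ∧
      ∃ m : UnitalMultiplication V u,
        letI : Ring V := m.toRing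
        letI : Algebra ℝ V := m.toAlgebra
        IsCommGHAlgebra (⊤ : Submodule ℝ V) ∧
        IsBanachAlgebraNorm (orderUnitNorm u : V → ℝ) ∧
        projections (⊤ : Submodule ℝ V) = characteristicElements u := by
  obtain ⟨X, _, E, hu, hE⟩ := hV.exists_linearEquiv_continuousMap hσ
  have hX : IsMonotoneSigmaComplete C(X, ℝ) :=
    hσ.of_orderIso { E.toEquiv with map_rel_iff' := hE _ _ }
  have hchar {e : V} := map_mem_idempotents_iff hu hE (e := e)
  constructor
  · let f : characteristicElements u ≃o {f : C(X, ℝ) | f * f = f} :=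
      { toEquiv := E.toEquiv.subtypeEquiv fun e => hchar.symm
        map_rel_iff' := hE _ _ }
    exact (ContinuousMap.isBooleanSigmaAlgebra_idempotents hX).of_orderIso f
  · refine ⟨.ofLinearEquiv E hu, ?_⟩
    let m := UnitalMultiplication.ofLinearEquiv E hu
    let : Ring V := m.toRing
    let : Algebra ℝ V := m.toAlgebra
    have hmul (v w : V) : E (v * w) = E v * E w := E.apply_symm_apply _
    let F : V ≃ₐ[ℝ] C(X, ℝ) := AlgEquiv.ofLinearEquiv E hu hmul
    refine ⟨isCommGHAlgebra_top_of_algEquiv hV.toIsOrderUnitNormedSpace F hE hX,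
      isBanachAlgebraNorm_orderUnitNorm_one F hE, Set.ext fun e => ?_⟩
    rw [← hchar, ← hmul, E.injective.eq_iff]
    exact ⟨fun h => h.2, fun h => ⟨trivial, h⟩⟩

theorem theorem4p5 :
    (∀ (R : Type*) [Ring R] [Algebra ℝ R] (A : Submodule ℝ R) [PartialOrder A]
      (hA : IsCommGHAlgebra A),
      IsOrderUnitNormedVectorLattice A ⟨1, hA.one_mem⟩ ∧ IsMonotoneSigmaComplete A) ∧
    (∀ (V : Type*) [AddCommGroup V] [Module ℝ V] [PartialOrder V] (u : V),
      IsOrderUnitNormedVectorLattice V u → IsMonotoneSigmaComplete V →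
      IsBooleanSigmaAlgebra (characteristicElements u) ∧
      ∃ m : UnitalMultiplication V u,
        letI : Ring V := m.toRing
        letI : Algebra ℝ V := m.toAlgebra
        IsCommGHAlgebra (⊤ : Submodule ℝ V) ∧
        IsBanachAlgebraNorm (orderUnitNorm u : V → ℝ) ∧
        projections (⊤ : Submodule ℝ V) = characteristicElements u) := by
  exact ⟨fun _ _ _ _ _ hA => ⟨hA.isOrderUnitNormedVectorLattice, hA.isMonotoneSigmaComplete⟩,
    fun _ _ _ _ _ hV hσ => hV.isBooleanSigmaAlgebra_and_exists_multiplication hσ⟩
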